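/- There exists a convex hyperbolic dodecahedron $C\subset\mathbb{H}^3$, i.e. a compact convex polyhedron with nonempty interior in three-dimensional hyperbolic space that has the combinatorial type of the regular dodecahedron, such that every (two-dimensional) face of $C$ is a regular hyperbolic pentagon (all five sides have equal length) with all interior angles equal to $\pi/2$, and such that the dihedral angle of $C$ between any two distinct faces sharing an edge is $\pi/2$. -/

import Mathlib

noncomputable section

namespace Hyp

/-- The Lorentzian form `-x₀y₀ + x₁y₁ + x₂y₂ + x₃y₃` on `ℝ⁴`. -/
def form (x y : Fin 4 → ℝ) : ℝ :=
  -(x 0 * y 0) + x 1 * y 1 + x 2 * y 2 + x 3 * y 3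

/-- Hyperbolic 3-space in the hyperboloid model, with the topology induced from `ℝ⁴`. -/
abbrev H3 : Type := {x : Fin 4 → ℝ // form x x = -1 ∧ 0 < x 0}

/-- The hyperbolic distance, `cosh (hdist x y) = -form x y`. -/
def hdist (x y : H3) : ℝ := Real.arcosh (-form x.1 y.1)

/-- The component of `y` tangent to the hyperboloid at `x`: it is orthogonal to `x`, and it is
a positive multiple of the initial velocity of the geodesic from `x` to `y` when `y ≠ x`. -/
def direction (x y : H3) : Fin 4 → ℝ := y.1 + form x.1 y.1 • x.1

/-- The angle between two spacelike vectors that span a spacelike plane. -/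
def vectorAngle (u v : Fin 4 → ℝ) : ℝ :=
  Real.arccos (form u v / (√(form u u) * √(form v v)))

/-- The angle at `x` between the geodesic segments from `x` to `y` and from `x` to `z`. -/
def angleAt (y x z : H3) : ℝ := vectorAngle (direction x y) (direction x z)

/-- The geodesic segment between `x` and `y`. Geodesics of the hyperboloid are its intersections
with linear planes, so the segment consists of the points of the hyperboloid which are
combinations of `x` and `y` with nonnegative coefficients. -/
def segment (x y : H3) : Set H3 :=
  {z | ∃ a b : ℝ, 0 ≤ a ∧ 0 ≤ b ∧ z.1 = a • x.1 + b • y.1}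

/-- Geodesic convexity. -/
def IsConvex (S : Set H3) : Prop := ∀ x ∈ S, ∀ y ∈ S, segment x y ⊆ S

/-- The geodesic convex hull. -/
def hull (S : Set H3) : Set H3 := ⋂₀ {T | IsConvex T ∧ S ⊆ T}

/-- The totally geodesic plane with normal vector `n` (meaningful for spacelike `n`). -/
def plane (n : Fin 4 → ℝ) : Set H3 := {x | form n x.1 = 0}

/-- The closed half-space bounded by `plane n` with outer normal `n`
(meaningful for spacelike `n`). -/
def halfSpace (n : Fin 4 → ℝ) : Set H3 := {x | form n x.1 ≤ 0}

/-- A compact convex polyhedron: a finite intersection of closed half-spaces which is compact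
and has nonempty interior. -/
structure IsConvexPolyhedron (C : Set H3) : Prop where
  isConvex : IsConvex C
  isCompact : IsCompact C
  nonempty_interior : (interior C).Nonempty
  eq_inter : ∃ N : Set (Fin 4 → ℝ), N.Finite ∧ (∀ n ∈ N, 0 < form n n) ∧ C = ⋂ n ∈ N, halfSpace n

/-- `F` is cut out on `C` by the plane with spacelike normal `n`, and `C` lies on the side of that
plane away from `n`. -/
def IsOuterNormal (C F : Set H3) (n : Fin 4 → ℝ) : Prop :=
  0 < form n n ∧ C ⊆ halfSpace n ∧ F = C ∩ plane n

/-- `F` is a `k`-dimensional face of `C`: it is cut out by a supporting plane, and the smallest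
totally geodesic subspace containing it (the trace of its linear span) has dimension `k`. -/
def IsFace (k : ℕ) (C F : Set H3) : Prop :=
  (∃ n, IsOuterNormal C F n) ∧
    Module.finrank ℝ (Submodule.span ℝ ((fun x : H3 => x.1) '' F)) = k + 1

/-- `v` is a vertex of `C`. -/
def IsVertex (C : Set H3) (v : H3) : Prop := IsFace 0 C {v}

/-- `F` and `G` are cut out on `C` by supporting planes whose interior dihedral angle (the
supplement of the angle between the outer normals) is `θ`. -/
def HasDihedralAngle (C F G : Set H3) (θ : ℝ) : Prop :=
  ∃ n m, IsOuterNormal C F n ∧ IsOuterNormal C G m ∧ Real.pi - vectorAngle n m = θ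

/-- `F` is a regular convex geodesic `k`-gon with interior angles `θ`: it lies in a totally
geodesic plane and is the convex hull of `k ≥ 3` distinct points `p i` in cyclic order, such that
the sides of `F` are the segments between consecutive points, all sides have the same length, and
all interior angles are `θ`. -/
def IsRegularPolygon (k : ℕ) (θ : ℝ) (F : Set H3) : Prop :=
  3 ≤ k ∧ ∃ p : ZMod k → H3, Function.Injective p ∧
    (∃ n, 0 < form n n ∧ F ⊆ plane n) ∧
    F = hull (Set.range p) ∧
    (∀ i, IsFace 1 F (segment (p i) (p (i + 1)))) ∧
    (∃ s : ℝ, ∀ i, hdist (p i) (p (i + 1)) = s) ∧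
    ∀ i, angleAt (p (i - 1)) (p i) (p (i + 1)) = θ

/-- The 20 vertices of a Euclidean regular dodecahedron: `(±1, ±1, ±1)` and the cyclic
permutations of `(0, ±φ, ±φ⁻¹)`, where `φ` is the golden ratio. -/
def euclVertices : Set (Fin 3 → ℝ) :=
  {v | (∀ i, |v i| = 1) ∨
    ∃ i, v i = 0 ∧ |v (i + 1)| = Real.goldenRatio ∧ |v (i + 2)| = Real.goldenRatio⁻¹}

/-- Normal vectors of the 12 faces of that dodecahedron: the cyclic permutations of
`(0, ±1, ±φ)`. The face with normal `n` lies in the plane `n ⬝ᵥ x = φ ^ 2`. -/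
def euclNormals : Set (Fin 3 → ℝ) :=
  {n | ∃ i, n i = 0 ∧ |n (i + 1)| = 1 ∧ |n (i + 2)| = Real.goldenRatio}

/-- `C` is a compact convex polyhedron of the combinatorial type of the regular dodecahedron:
there are bijections between the vertices and between the two-dimensional faces which preserve
and reflect the incidence of vertices and faces. -/
def IsConvexDodecahedron (C : Set H3) : Prop :=
  IsConvexPolyhedron C ∧
    ∃ (e : euclVertices ≃ {v : H3 // IsVertex C v}) (f : euclNormals ≃ {F : Set H3 // IsFace 2 C F}),
      ∀ v n, (e v).1 ∈ (f n).1 ↔ n.1 ⬝ᵥ v.1 = Real.goldenRatio ^ 2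

end Hyp

end

/-!
Linear spans turn geodesic convexity on the hyperboloid into the convexity of cones in `ℝ⁴`, and
the cone over a dodecahedron centred at `(1, 0, 0, 0)` is, up to rescaling the time axis, the cone
over the Euclidean dodecahedron. The scale is a free parameter: the outer normals of the
hyperbolic faces are `(t, n)` with `n` a Euclidean normal, and the Lorentzian product of two of
them is `n ⬝ᵥ m - t ^ 2`. Adjacent Euclidean faces have `n ⬝ᵥ m = φ`, so `t = √φ` makes all
dihedral angles right. The angles of the faces and the equality of their sides follow from the
Euclidean dot products of the vertices.

That the vertices and the half-spaces describe the same polyhedron is thus a statement about the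
Euclidean dodecahedron. The signed cyclic permutations of the coordinates preserve it and act
transitively on its faces, which reduces everything to the face with normal `(0, 1, φ)`.
-/

noncomputable section

namespace Hyp

open Real Topology

local notation "φ" => Real.goldenRatio

/-! ### The hyperboloid -/

theorem form_comm (x y : Fin 4 → ℝ) : form x y = form y x := by
  simp only [form]; ring

theorem form_add_right (x y z : Fin 4 → ℝ) : form x (y + z) = form x y + form x z := by
  simp only [form, Pi.add_apply]; ring

theorem form_smul_right (c : ℝ) (x y : Fin 4 → ℝ) : form x (c • y) = c * form x y := by
  simp only [form, Pi.smul_apply, smul_eq_mul]; ring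

theorem form_add_left (x y z : Fin 4 → ℝ) : form (x + y) z = form x z + form y z := by
  rw [form_comm, form_add_right, form_comm z, form_comm z]

theorem form_smul_left (c : ℝ) (x y : Fin 4 → ℝ) : form (c • x) y = c * form x y := by
  rw [form_comm, form_smul_right, form_comm y]

/-- The Lorentzian product with `n` as a linear functional; its kernel is the linear hyperplane
whose trace on hyperbolic space is `plane n`. -/
def formL (n : Fin 4 → ℝ) : Module.Dual ℝ (Fin 4 → ℝ) where
  toFun := form n
  map_add' := form_add_right n
  map_smul' c := form_smul_right c n

theorem formL_apply (n x : Fin 4 → ℝ) : formL n x = form n x := rfl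

theorem form_zero_right (n : Fin 4 → ℝ) : form n 0 = 0 := (formL n).map_zero

theorem continuous_form_right (n : Fin 4 → ℝ) : Continuous (form n) := by
  unfold form; fun_prop

theorem finrank_ker_formL {n : Fin 4 → ℝ} (hn : 0 < form n n) :
    Module.finrank ℝ (LinearMap.ker (formL n)) = 3 := by
  have hne : formL n ≠ 0 := fun h => hn.ne' (by rw [← formL_apply, h, LinearMap.zero_apply])
  simpa using Module.Dual.finrank_ker_add_one_of_ne_zero hne

theorem H3.ne_zero (x : H3) : x.1 ≠ 0 := fun h =>
  x.2.2.ne' (congrFun h 0)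

theorem H3.one_le_time (x : H3) : 1 ≤ x.1 0 := by
  obtain ⟨x, hx, hx0⟩ := x
  simp only [form] at hx ⊢
  nlinarith [sq_nonneg (x 1), sq_nonneg (x 2), sq_nonneg (x 3)]

theorem H3.eq_of_eq_smul {x y : H3} {c : ℝ} (hc : 0 ≤ c) (h : x.1 = c • y.1) : x = y := by
  have hx := x.2.1
  rw [h, form_smul_left, form_smul_right, y.2.1] at hx
  have hc1 : c = 1 := by nlinarith
  exact Subtype.ext (by rw [h, hc1, one_smul])

theorem form_le_neg_one (x y : H3) : form x.1 y.1 ≤ -1 := by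
  have hx1 := x.one_le_time
  have hy1 := y.one_le_time
  have hx := x.2.1
  have hy := y.2.1
  generalize x.1 = x at *
  generalize y.1 = y at *
  simp only [form] at hx hy ⊢
  have hxy : 1 ≤ x 0 * y 0 := one_le_mul_of_one_le_of_one_le hx1 hy1
  have cauchy_schwarz :
      (x 1 * y 1 + x 2 * y 2 + x 3 * y 3) ^ 2 ≤ (x 0 ^ 2 - 1) * (y 0 ^ 2 - 1) := by
    rw [show x 0 ^ 2 - 1 = x 1 ^ 2 + x 2 ^ 2 + x 3 ^ 2 by linarith,
      show y 0 ^ 2 - 1 = y 1 ^ 2 + y 2 ^ 2 + y 3 ^ 2 by linarith]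
    nlinarith [sq_nonneg (x 1 * y 2 - x 2 * y 1), sq_nonneg (x 1 * y 3 - x 3 * y 1),
      sq_nonneg (x 2 * y 3 - x 3 * y 2)]
  have spatial_le : x 1 * y 1 + x 2 * y 2 + x 3 * y 3 ≤ x 0 * y 0 - 1 :=
    le_of_sq_le_sq (by nlinarith [sq_nonneg (x 0 - y 0)]) (by linarith)
  linarith

theorem left_mem_segment (x y : H3) : x ∈ segment x y :=
  ⟨1, 0, zero_le_one, le_rfl, by simp⟩

theorem right_mem_segment (x y : H3) : y ∈ segment x y :=
  ⟨0, 1, le_rfl, zero_le_one, by simp⟩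

theorem exists_mem_segment_add_eq_smul (x y : H3) {c d : ℝ} (hc : 0 < c) (hd : 0 < d) :
    ∃ z ∈ segment x y, ∃ e : ℝ, 0 < e ∧ c • x.1 + d • y.1 = e • z.1 := by
  set w := c • x.1 + d • y.1 with hw
  have timelike : 0 < -form w w := by
    have hxy := mul_le_mul_of_nonneg_left (form_le_neg_one x y) (mul_pos hc hd).le
    simp only [hw, form_add_left, form_add_right, form_smul_left, form_smul_right, x.2.1, y.2.1,
      form_comm y.1 x.1]
    nlinarith [mul_pos hc hd]
  have future : 0 < w 0 := add_pos (mul_pos hc x.2.2) (mul_pos hd y.2.2)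
  set r := √(-form w w)
  have hr0 : 0 < r := Real.sqrt_pos.2 timelike
  have hr2 : r * r = -form w w := Real.mul_self_sqrt timelike.le
  refine ⟨⟨r⁻¹ • w, ?_, mul_pos (inv_pos.2 hr0) future⟩,
    ⟨r⁻¹ * c, r⁻¹ * d, by positivity, by positivity, ?_⟩, r, hr0, ?_⟩
  · rw [form_smul_left, form_smul_right, show form w w = -(r * r) by linarith]
    field_simp
  · change r⁻¹ • w = _
    rw [hw, smul_add, smul_smul, smul_smul]
  · rw [smul_smul, mul_inv_cancel₀ hr0.ne', one_smul]

/-! ### Convexity -/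

theorem IsConvex.inter {S T : Set H3} (hS : IsConvex S) (hT : IsConvex T) : IsConvex (S ∩ T) :=
  fun x hx y hy => Set.subset_inter (hS x hx.1 y hy.1) (hT x hx.2 y hy.2)

theorem isConvex_setOf_mem (K : PointedCone ℝ (Fin 4 → ℝ)) : IsConvex {x | x.1 ∈ K} := by
  rintro x hx y hy z ⟨a, b, ha, hb, hz⟩
  change z.1 ∈ K
  rw [hz]
  exact K.add_mem (K.smul_mem ha hx) (K.smul_mem hb hy)

theorem isConvex_halfSpace (n : Fin 4 → ℝ) : IsConvex (halfSpace n) := by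
  rintro x hx y hy z ⟨a, b, ha, hb, hz⟩
  change form n z.1 ≤ 0
  rw [hz, form_add_right, form_smul_right, form_smul_right]
  exact add_nonpos (mul_nonpos_of_nonneg_of_nonpos ha hx) (mul_nonpos_of_nonneg_of_nonpos hb hy)

theorem isConvex_plane (n : Fin 4 → ℝ) : IsConvex (plane n) := by
  rintro x (hx : form n x.1 = 0) y (hy : form n y.1 = 0) z ⟨a, b, -, -, hz⟩
  change form n z.1 = 0
  rw [hz, form_add_right, form_smul_right, form_smul_right, hx, hy, mul_zero, mul_zero, add_zero]

theorem isConvex_singleton (x : H3) : IsConvex {x} := by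
  rintro _ rfl _ rfl z ⟨a, b, ha, hb, hz⟩
  exact H3.eq_of_eq_smul (add_nonneg ha hb) (by rw [hz, add_smul])

/-- These sets are the balls about `(1, 0, 0, 0)`. -/
theorem isConvex_setOf_time_le (c : ℝ) : IsConvex {x | x.1 0 ≤ c} := by
  rintro x (hx : x.1 0 ≤ c) y (hy : y.1 0 ≤ c) z ⟨a, b, ha, hb, hz⟩
  have hab : a + b ≤ 1 := by
    have hz1 := z.2.1
    simp only [hz, form_add_left, form_add_right, form_smul_left, form_smul_right, x.2.1, y.2.1,
      form_comm y.1 x.1] at hz1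
    nlinarith [mul_le_mul_of_nonneg_left (form_le_neg_one x y) (mul_nonneg ha hb)]
  have hc : 0 ≤ c := x.2.2.le.trans hx
  calc z.1 0 = a * x.1 0 + b * y.1 0 := congrFun hz 0
    _ ≤ a * c + b * c := by gcongr
    _ ≤ c := by nlinarith

theorem hull_subset {S T : Set H3} (hT : IsConvex T) (hST : S ⊆ T) : hull S ⊆ T :=
  Set.sInter_subset_of_mem ⟨hT, hST⟩

theorem subset_hull (S : Set H3) : S ⊆ hull S := fun _ hx _ hT => hT.2 hx

theorem hull_singleton (x : H3) : hull {x} = {x} :=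
  (hull_subset (isConvex_singleton x) subset_rfl).antisymm (subset_hull _)

theorem nonempty_of_nonempty_hull {S : Set H3} (h : (hull S).Nonempty) : S.Nonempty := by
  rw [Set.nonempty_iff_ne_empty] at h ⊢
  rintro rfl
  exact h (Set.subset_empty_iff.1 (hull_subset (fun _ hx => hx.elim) subset_rfl))

/-! ### Hulls and linear cones -/

/-- The linear cone generated by a set of points of hyperbolic space. Its trace on the hyperboloid
is the geodesic convex hull, see `mem_hull_iff`. -/
def coneSpan (S : Set H3) : PointedCone ℝ (Fin 4 → ℝ) :=
  PointedCone.hull ℝ ((fun x : H3 => x.1) '' S)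

theorem mem_coneSpan {S : Set H3} {x : H3} (hx : x ∈ S) : x.1 ∈ coneSpan S :=
  PointedCone.subset_hull ⟨x, hx, rfl⟩

theorem coneSpan_mono {S T : Set H3} (h : S ⊆ T) : coneSpan S ≤ coneSpan T :=
  Submodule.span_mono (Set.image_mono h)

theorem eq_zero_or_exists_eq_smul_of_mem_coneSpan {S : Set H3} (hS : IsConvex S)
    {z : Fin 4 → ℝ} (hz : z ∈ coneSpan S) : z = 0 ∨ ∃ x ∈ S, ∃ c : ℝ, 0 < c ∧ z = c • x.1 := by
  induction hz using Submodule.span_induction with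
  | mem z hz =>
    obtain ⟨x, hx, rfl⟩ := hz
    exact .inr ⟨x, hx, 1, one_pos, (one_smul ℝ x.1).symm⟩
  | zero => exact .inl rfl
  | add z w _ _ hz hw =>
    rcases hz with rfl | ⟨x, hx, c, hc, rfl⟩
    · rwa [zero_add]
    rcases hw with rfl | ⟨y, hy, d, hd, rfl⟩
    · rw [add_zero]
      exact .inr ⟨x, hx, c, hc, rfl⟩
    obtain ⟨v, hv, e, he, h⟩ := exists_mem_segment_add_eq_smul x y hc hd
    exact .inr ⟨v, hS x hx y hy hv, e, he, h⟩
  | smul a z _ hz =>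
    rcases hz with rfl | ⟨x, hx, c, hc, rfl⟩
    · exact .inl (smul_zero a)
    rcases a.2.eq_or_lt with ha | ha
    · exact .inl (by rw [show a = 0 from Subtype.ext ha.symm, zero_smul])
    · exact .inr ⟨x, hx, a * c, mul_pos ha hc, smul_smul (a : ℝ) c x.1⟩

theorem mem_hull_iff {S : Set H3} {x : H3} : x ∈ hull S ↔ x.1 ∈ coneSpan S := by
  refine ⟨fun hx => hull_subset (T := {x | x.1 ∈ coneSpan S}) (isConvex_setOf_mem _)
    (fun _ hy => mem_coneSpan hy) hx, fun hx T ⟨hT, hST⟩ => ?_⟩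
  rcases eq_zero_or_exists_eq_smul_of_mem_coneSpan hT (coneSpan_mono hST hx) with
    h | ⟨y, hy, c, hc, h⟩
  · exact (x.ne_zero h).elim
  · rwa [H3.eq_of_eq_smul hc.le h]

theorem hull_pair (x y : H3) : hull {x, y} = segment x y := by
  ext z
  rw [mem_hull_iff, coneSpan, Set.image_pair]
  refine Submodule.mem_span_pair.trans ⟨?_, ?_⟩
  · rintro ⟨a, b, h⟩
    exact ⟨a, b, a.2, b.2, h.symm⟩
  · rintro ⟨a, b, ha, hb, h⟩
    exact ⟨⟨a, ha⟩, ⟨b, hb⟩, h.symm⟩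

theorem coneSpan_inter_plane {S : Set H3} {m z : Fin 4 → ℝ} (hS : S ⊆ halfSpace m)
    (hz : z ∈ coneSpan S) (hm : form m z = 0) : z ∈ coneSpan (S ∩ plane m) := by
  suffices h : form m z ≤ 0 ∧ (form m z = 0 → z ∈ coneSpan (S ∩ plane m)) from h.2 hm
  clear hm
  induction hz using Submodule.span_induction with
  | mem z hz =>
    obtain ⟨x, hx, rfl⟩ := hz
    exact ⟨hS hx, fun hm => mem_coneSpan ⟨hx, hm⟩⟩
  | zero => exact ⟨(form_zero_right m).le, fun _ => zero_mem _⟩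
  | add z w _ _ hz hw =>
    rw [form_add_right]
    exact ⟨add_nonpos hz.1 hw.1, fun h =>
      add_mem (hz.2 (by linarith [hz.1, hw.1])) (hw.2 (by linarith [hz.1, hw.1]))⟩
  | smul a z _ hz =>
    have ha : (0 : ℝ) ≤ a := a.2
    have h_smul : form m (a • z) = (a : ℝ) * form m z := form_smul_right a m z
    rw [h_smul]
    refine ⟨mul_nonpos_of_nonneg_of_nonpos ha hz.1, fun h => ?_⟩
    rcases mul_eq_zero.1 h with h | h
    · rw [show a = 0 from Subtype.ext h, zero_smul]
      exact zero_mem _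
    · exact Submodule.smul_mem _ a (hz.2 h)

theorem hull_inter_plane {S : Set H3} {m : Fin 4 → ℝ} (hS : S ⊆ halfSpace m) :
    hull S ∩ plane m = hull (S ∩ plane m) := by
  refine Set.Subset.antisymm (fun x hx => ?_) (Set.subset_inter ?_ ?_)
  · exact mem_hull_iff.2 (coneSpan_inter_plane hS (mem_hull_iff.1 hx.1) hx.2)
  · exact fun x hx => mem_hull_iff.2 (coneSpan_mono Set.inter_subset_left (mem_hull_iff.1 hx))
  · exact hull_subset (isConvex_plane m) Set.inter_subset_right

/-! ### Compactness -/

theorem H3.isClosedEmbedding_val : IsClosedEmbedding (Subtype.val : H3 → Fin 4 → ℝ) := by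
  refine IsClosed.isClosedEmbedding_subtypeVal ?_
  have h : {x : Fin 4 → ℝ | form x x = -1 ∧ 0 < x 0} = {x | form x x = -1} ∩ {x | 1 ≤ x 0} := by
    ext x
    exact ⟨fun hx => ⟨hx.1, H3.one_le_time ⟨x, hx⟩⟩, fun hx => ⟨hx.1, one_pos.trans_le hx.2⟩⟩
  change IsClosed {x : Fin 4 → ℝ | form x x = -1 ∧ 0 < x 0}
  rw [h]
  exact (isClosed_eq (by unfold form; fun_prop) continuous_const).inter
    (isClosed_le continuous_const (continuous_apply 0))

theorem isCompact_setOf_time_le (c : ℝ) : IsCompact {x : H3 | x.1 0 ≤ c} := by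
  refine (H3.isClosedEmbedding_val.isCompact_preimage (isCompact_closedBall 0 c)).of_isClosed_subset
    (isClosed_le ((continuous_apply 0).comp continuous_subtype_val) continuous_const)
    fun x (hx : x.1 0 ≤ c) => ?_
  have hx0 := x.2.2
  rw [Set.mem_preimage, mem_closedBall_zero_iff, pi_norm_le_iff_of_nonneg (hx0.le.trans hx)]
  refine fun j => (abs_le_of_sq_le_sq ?_ hx0.le).trans hx
  have hx1 := x.2.1
  simp only [form] at hx1
  fin_cases j <;> simp only [Fin.zero_eta, Fin.mk_one, Fin.reduceFinMk] <;>
    nlinarith [sq_nonneg (x.1 1), sq_nonneg (x.1 2), sq_nonneg (x.1 3)]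

theorem isCompact_hull {S : Set H3} (hS : BddAbove ((fun x : H3 => x.1 0) '' S))
    (hclosed : IsClosed (hull S)) : IsCompact (hull S) := by
  obtain ⟨c, hc⟩ := hS
  exact (isCompact_setOf_time_le c).of_isClosed_subset hclosed
    (hull_subset (isConvex_setOf_time_le c) fun x hx => hc ⟨x, hx, rfl⟩)

/-! ### Polyhedra and their faces -/

/-- The intersection of the half-spaces with outer normals in `N`. -/
def polyhedron (N : Set (Fin 4 → ℝ)) : Set H3 := ⋂ n ∈ N, halfSpace n

section Polyhedra

variable {N : Set (Fin 4 → ℝ)} {C E F S : Set H3} {n m : Fin 4 → ℝ}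

theorem mem_polyhedron {x : H3} : x ∈ polyhedron N ↔ ∀ n ∈ N, form n x.1 ≤ 0 :=
  Set.mem_iInter₂

theorem isConvex_polyhedron (N : Set (Fin 4 → ℝ)) : IsConvex (polyhedron N) :=
  fun x hx y hy _ hz => mem_polyhedron.2 fun n hn =>
    isConvex_halfSpace n x (mem_polyhedron.1 hx n hn) y (mem_polyhedron.1 hy n hn) hz

theorem isClosed_polyhedron (N : Set (Fin 4 → ℝ)) : IsClosed (polyhedron N) :=
  isClosed_biInter fun n _ =>
    isClosed_le ((continuous_form_right n).comp continuous_subtype_val) continuous_const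

theorem mem_interior_polyhedron (hN : N.Finite) {x : H3} (hx : ∀ n ∈ N, form n x.1 < 0) :
    x ∈ interior (polyhedron N) := by
  refine mem_interior.2 ⟨⋂ n ∈ N, {y : H3 | form n y.1 < 0},
    Set.iInter₂_mono fun n _ y (hy : form n y.1 < 0) => hy.le,
    hN.isOpen_biInter fun n _ => ?_, Set.mem_iInter₂.2 hx⟩
  exact isOpen_lt ((continuous_form_right n).comp continuous_subtype_val) continuous_const

theorem isOuterNormal_inter_plane (hn : n ∈ N) (hpos : 0 < form n n) :
    IsOuterNormal (polyhedron N) (polyhedron N ∩ plane n) n :=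
  ⟨hpos, Set.biInter_subset_of_mem hn, rfl⟩

theorem exists_forall_form_neg (hN : N.Finite) (hF : IsConvex F) (hne : F.Nonempty)
    (hle : ∀ n ∈ N, F ⊆ halfSpace n) (hlt : ∀ n ∈ N, ¬F ⊆ plane n) :
    ∃ x ∈ F, ∀ n ∈ N, form n x.1 < 0 := by
  induction N, hN using Set.Finite.induction_on with
  | empty => exact hne.imp fun x hx => ⟨hx, fun _ h => h.elim⟩
  | @insert k N _ _ ih =>
    simp only [Set.forall_mem_insert] at hle hlt ⊢
    obtain ⟨x, hx, hxN⟩ := ih hle.2 hlt.2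
    obtain ⟨y, hy, hyk⟩ := Set.not_subset.1 hlt.1
    obtain ⟨z, hz, c, hc, h⟩ := exists_mem_segment_add_eq_smul x y one_pos one_pos
    rw [one_smul, one_smul] at h
    have form_add_eq (k) : form k x.1 + form k y.1 = c * form k z.1 := by
      rw [← form_add_right, h, form_smul_right]
    have hyk : form k y.1 < 0 := lt_of_le_of_ne (hle.1 hy) hyk
    refine ⟨z, hF x hx y hy hz, ?_, fun n hn => ?_⟩
    · exact neg_of_mul_neg_right (form_add_eq k ▸ add_neg_of_nonpos_of_neg (hle.1 hx) hyk) hc.le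
    · exact neg_of_mul_neg_right
        (form_add_eq n ▸ add_neg_of_neg_of_nonpos (hxN n hn) (hle.2 n hn hy)) hc.le

theorem IsOuterNormal.disjoint_interior (h : IsOuterNormal C F m) : Disjoint F (interior C) := by
  obtain ⟨hm, hC, rfl⟩ := h
  refine Set.disjoint_left.2 fun x ⟨_, (hxm : form m x.1 = 0)⟩ hx => ?_
  obtain ⟨U, hU, hUC⟩ := isOpen_induced_iff.1 (isOpen_interior (s := C))
  -- the geodesic through `x` in the direction `m`, up to parametrization
  let γ (t : ℝ) : Fin 4 → ℝ := √(1 + t ^ 2 * form m m) • x.1 + t • m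
  have hγ : Continuous γ := by fun_prop
  have hγ0 : γ 0 = x.1 := by simp [γ]
  have hopen : IsOpen (U ∩ {z | 0 < z 0}) :=
    hU.inter (isOpen_lt continuous_const (continuous_apply 0))
  have hx0 : γ 0 ∈ U ∩ {z | 0 < z 0} := hγ0 ▸ ⟨(Set.ext_iff.1 hUC x).2 hx, x.2.2⟩
  have hnear : ∀ᶠ t in 𝓝[>] 0, γ t ∈ U ∩ {z | 0 < z 0} :=
    nhdsWithin_le_nhds (hγ.continuousAt.eventually_mem (hopen.mem_nhds hx0))
  obtain ⟨t, ⟨htU, ht0⟩, ht⟩ := (hnear.and self_mem_nhdsWithin).exists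
  have hyp : form (γ t) (γ t) = -1 := by
    have hs := Real.mul_self_sqrt (show 0 ≤ 1 + t ^ 2 * form m m by positivity)
    simp only [γ, form_add_left, form_add_right, form_smul_left, form_smul_right, x.2.1,
      form_comm x.1 m, hxm]
    linear_combination -hs
  have hγC : (⟨γ t, hyp, ht0⟩ : H3) ∈ C := interior_subset ((Set.ext_iff.1 hUC _).1 htU)
  have hle : form m (γ t) ≤ 0 := hC hγC
  rw [form_add_right, form_smul_right, form_smul_right, hxm, mul_zero, zero_add] at hle
  exact hle.not_gt (mul_pos ht hm)

theorem IsOuterNormal.exists_subset_plane (hN : N.Finite) (h : IsOuterNormal (polyhedron N) F m)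
    (hne : F.Nonempty) : ∃ n ∈ N, F ⊆ plane n := by
  by_contra! hlt
  have hF : IsConvex F := h.2.2 ▸ (isConvex_polyhedron N).inter (isConvex_plane m)
  have hle : ∀ n ∈ N, F ⊆ halfSpace n := fun n hn =>
    h.2.2 ▸ Set.inter_subset_left.trans (Set.biInter_subset_of_mem hn)
  obtain ⟨x, hxF, hx⟩ := exists_forall_form_neg hN hF hne hle hlt
  exact Set.disjoint_left.1 h.disjoint_interior hxF (mem_interior_polyhedron hN hx)

/-- The linear span of a set of points of hyperbolic space, which defines the dimension of a
face. -/
def linearSpan (F : Set H3) : Submodule ℝ (Fin 4 → ℝ) :=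
  Submodule.span ℝ ((fun x : H3 => x.1) '' F)

theorem linearSpan_le_ker (hF : F ⊆ plane n) : linearSpan F ≤ LinearMap.ker (formL n) :=
  Submodule.span_le.2 (Set.image_subset_iff.2 hF)

theorem finrank_linearSpan_singleton (x : H3) : Module.finrank ℝ (linearSpan {x}) = 1 := by
  rw [linearSpan, Set.image_singleton, finrank_span_singleton x.ne_zero]

theorem finrank_linearSpan_lt (hEF : E ⊆ F) (hE : E ⊆ plane m) (hF : ¬F ⊆ plane m) :
    Module.finrank ℝ (linearSpan E) < Module.finrank ℝ (linearSpan F) := by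
  refine Submodule.finrank_lt_finrank_of_lt
    (lt_of_le_of_ne (Submodule.span_mono (Set.image_mono hEF)) fun h => hF fun x hx => ?_)
  exact linearSpan_le_ker hE (h ▸ Submodule.subset_span ⟨x, hx, rfl⟩)

theorem finrank_linearSpan_segment {x y : H3} (hxy : x ≠ y) :
    Module.finrank ℝ (linearSpan (segment x y)) = 2 := by
  have hspan : linearSpan (segment x y) = Submodule.span ℝ (Set.range ![x.1, y.1]) := by
    rw [Matrix.range_cons_cons_empty]
    refine le_antisymm (Submodule.span_le.2 ?_) (Submodule.span_mono ?_)
    · rintro _ ⟨z, ⟨a, b, -, -, hz⟩, rfl⟩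
      exact Submodule.mem_span_pair.2 ⟨a, b, hz.symm⟩
    · rintro _ (rfl | rfl)
      exacts [⟨x, left_mem_segment x y, rfl⟩, ⟨y, right_mem_segment x y, rfl⟩]
  have hli : LinearIndependent ℝ ![x.1, y.1] := by
    refine (LinearIndependent.pair_iff' x.ne_zero).2 fun a h => hxy ?_
    have h0 : a * x.1 0 = y.1 0 := congrFun h 0
    have ha : 0 < a := pos_of_mul_pos_left (h0 ▸ y.2.2) x.2.2.le
    exact (H3.eq_of_eq_smul ha.le h.symm).symm
  rw [hspan, finrank_span_eq_card hli, Fintype.card_fin]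

theorem linearSpan_eq_ker (hn : 0 < form n n) (hF : F ⊆ plane n)
    (hdim : Module.finrank ℝ (linearSpan F) = 3) : linearSpan F = LinearMap.ker (formL n) :=
  Submodule.eq_of_le_of_finrank_eq (linearSpan_le_ker hF) (by rw [hdim, finrank_ker_formL hn])

theorem ker_formL_eq_of_subset_plane (hn : 0 < form n n) (hm : 0 < form m m) (hFn : F ⊆ plane n)
    (hFm : F ⊆ plane m) (hdim : Module.finrank ℝ (linearSpan F) = 3) :
    LinearMap.ker (formL n) = LinearMap.ker (formL m) :=
  (linearSpan_eq_ker hn hFn hdim).symm.trans (linearSpan_eq_ker hm hFm hdim)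

theorem IsFace.nonempty {k : ℕ} (hF : IsFace k C F) : F.Nonempty := by
  rw [Set.nonempty_iff_ne_empty]
  rintro rfl
  have hdim := hF.2
  rw [Set.image_empty, Submodule.span_empty, finrank_bot] at hdim
  omega

theorem IsFace.exists_eq_inter_plane (hN : N.Finite) (hpos : ∀ n ∈ N, 0 < form n n)
    (hF : IsFace 2 (polyhedron N) F) : ∃ n ∈ N, F = polyhedron N ∩ plane n := by
  obtain ⟨m, hm⟩ := hF.1
  obtain ⟨n, hn, hFn⟩ := hm.exists_subset_plane hN hF.nonempty
  have hFm : F ⊆ plane m := hm.2.2 ▸ Set.inter_subset_right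
  have hker := ker_formL_eq_of_subset_plane hm.1 (hpos n hn) hFm hFn hF.2
  have hplane : plane m = plane n := Set.ext fun x => SetLike.ext_iff.1 hker x.1
  exact ⟨n, hn, hplane ▸ hm.2.2⟩

theorem IsVertex.mem_of_hull {x : H3} (hx : IsVertex (hull S) x) : x ∈ S := by
  obtain ⟨⟨m, -, hm, hxm⟩, -⟩ := hx
  rw [hull_inter_plane ((subset_hull S).trans hm)] at hxm
  obtain ⟨y, hy⟩ := nonempty_of_nonempty_hull (hxm ▸ Set.singleton_nonempty x)
  have hyx : y = x := by rw [← Set.mem_singleton_iff, hxm]; exact subset_hull _ hy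
  exact hyx ▸ hy.1

theorem isVertex_hull {x : H3} (hm : 0 < form m m) (hS : S ⊆ halfSpace m)
    (hx : S ∩ plane m = {x}) : IsVertex (hull S) x := by
  refine ⟨⟨m, hm, hull_subset (isConvex_halfSpace m) hS, ?_⟩, finrank_linearSpan_singleton x⟩
  rw [hull_inter_plane hS, hx, hull_singleton]

/-! ### Angles -/

theorem vectorAngle_eq_pi_div_two {u v : Fin 4 → ℝ} (h : form u v = 0) :
    vectorAngle u v = π / 2 := by
  rw [vectorAngle, h, zero_div, Real.arccos_zero]

theorem form_direction (x y z : H3) :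
    form (direction x y) (direction x z) = form y.1 z.1 + form x.1 y.1 * form x.1 z.1 := by
  simp only [direction, form_add_left, form_add_right, form_smul_left, form_smul_right, x.2.1,
    form_comm y.1 x.1]
  ring

/-- The hypothesis is the hyperbolic Pythagorean theorem `cosh c = cosh a * cosh b`. -/
theorem angleAt_eq_pi_div_two {x y z : H3} (h : form y.1 z.1 = -(form x.1 y.1 * form x.1 z.1)) :
    angleAt y x z = π / 2 :=
  vectorAngle_eq_pi_div_two (by rw [form_direction, h, neg_add_cancel])

theorem hasDihedralAngle_pi_div_two {G : Set H3} (hn : IsOuterNormal C F n)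
    (hm : IsOuterNormal C G m) (h : form n m = 0) : HasDihedralAngle C F G (π / 2) :=
  ⟨n, m, hn, hm, by rw [vectorAngle_eq_pi_div_two h]; ring⟩

end Polyhedra

/-! ### The Euclidean dodecahedron -/

theorem inv_goldenRatio_eq : φ⁻¹ = φ - 1 := by
  linarith [inv_goldenRatio, goldenRatio_add_goldenConj]

theorem eight_fifths_lt_goldenRatio : 8 / 5 < φ := by
  nlinarith [goldenRatio_sq, goldenRatio_pos]

theorem goldenRatio_pow_three : φ ^ 3 = 2 * φ + 1 := by
  linear_combination (φ + 1) * goldenRatio_sq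

section DotProduct

variable {ι : Type*} [Fintype ι] {x y : ι → ℝ} {c : ℝ}

theorem dotProduct_self_nonneg (x : ι → ℝ) : 0 ≤ x ⬝ᵥ x :=
  by
  simpa only [star_trivial] using dotProduct_star_self_nonneg x

theorem dotProduct_le_of_dotProduct_self_eq
    (hx : x ⬝ᵥ x = c) (hy : y ⬝ᵥ y = c) : x ⬝ᵥ y ≤ c := by
  have hsq : 0 ≤ (x - y) ⬝ᵥ (x - y) := dotProduct_self_nonneg _
  rw [sub_dotProduct, dotProduct_sub, dotProduct_sub, hx, hy, dotProduct_comm y] at hsq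
  linarith

theorem eq_of_dotProduct_eq_self (hx : x ⬝ᵥ x = c)
    (hy : y ⬝ᵥ y = c) (hxy : x ⬝ᵥ y = c) : x = y := by
  rw [← sub_eq_zero, ← dotProduct_self_eq_zero, sub_dotProduct, dotProduct_sub, dotProduct_sub,
    hx, hy, dotProduct_comm y, hxy, sub_self]

end DotProduct

theorem mem_euclVertices_iff {v : Fin 3 → ℝ} :
    v ∈ euclVertices ↔ (|v 0| = 1 ∧ |v 1| = 1 ∧ |v 2| = 1) ∨
      (v 0 = 0 ∧ |v 1| = φ ∧ |v 2| = φ - 1) ∨ (v 1 = 0 ∧ |v 2| = φ ∧ |v 0| = φ - 1) ∨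
      (v 2 = 0 ∧ |v 0| = φ ∧ |v 1| = φ - 1) := by
  simp only [euclVertices, Set.mem_ofPred_eq, inv_goldenRatio_eq, Fin.forall_fin_succ,
    Fin.exists_fin_succ, IsEmpty.forall_iff, IsEmpty.exists_iff, and_true, or_false]
  rfl

theorem mem_euclNormals_iff {n : Fin 3 → ℝ} :
    n ∈ euclNormals ↔ (n 0 = 0 ∧ |n 1| = 1 ∧ |n 2| = φ) ∨ (n 1 = 0 ∧ |n 2| = 1 ∧ |n 0| = φ) ∨
      (n 2 = 0 ∧ |n 0| = 1 ∧ |n 1| = φ) := by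
  simp only [euclNormals, Set.mem_ofPred_eq, Fin.exists_fin_succ, IsEmpty.exists_iff, or_false]
  rfl

theorem finite_euclNormals : euclNormals.Finite := by
  have hfin : ({0, 1, -1, φ, -φ} : Set ℝ).Finite := by simp
  refine (Set.Finite.pi' fun _ : Fin 3 => hfin).subset fun n hn => ?_
  simp only [Set.mem_ofPred_eq, Fin.forall_fin_succ, Set.mem_insert_iff, Set.mem_singleton_iff]
  rcases mem_euclNormals_iff.1 hn with ⟨h, h', h''⟩ | ⟨h, h', h''⟩ | ⟨h, h', h''⟩ <;>
    have h' := eq_or_eq_neg_of_abs_eq h' <;> have h'' := eq_or_eq_neg_of_abs_eq h'' <;>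
    refine ⟨?_, ?_, ?_, fun i => i.elim0⟩ <;>
    tauto

theorem dotProduct_self_of_mem_euclVertices {v : Fin 3 → ℝ} (hv : v ∈ euclVertices) :
    v ⬝ᵥ v = 3 := by
  rw [Matrix.vec3_dotProduct, ← abs_mul_abs_self (v 0), ← abs_mul_abs_self (v 1),
    ← abs_mul_abs_self (v 2)]
  rcases mem_euclVertices_iff.1 hv with
    ⟨h, h', h''⟩ | ⟨h, h', h''⟩ | ⟨h, h', h''⟩ | ⟨h, h', h''⟩ <;>
    simp only [h, h', h'', abs_zero] <;>
    linarith [goldenRatio_sq]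

theorem dotProduct_self_of_mem_euclNormals {n : Fin 3 → ℝ} (hn : n ∈ euclNormals) :
    n ⬝ᵥ n = φ + 2 := by
  rw [Matrix.vec3_dotProduct, ← abs_mul_abs_self (n 0), ← abs_mul_abs_self (n 1),
    ← abs_mul_abs_self (n 2)]
  rcases mem_euclNormals_iff.1 hn with ⟨h, h', h''⟩ | ⟨h, h', h''⟩ | ⟨h, h', h''⟩ <;>
    simp only [h, h', h'', abs_zero] <;>
    linarith [goldenRatio_sq]

theorem neg_mem_euclVertices {v : Fin 3 → ℝ} (hv : v ∈ euclVertices) : -v ∈ euclVertices := by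
  simpa only [euclVertices, Set.mem_ofPred_eq, Pi.neg_apply, abs_neg, neg_eq_zero] using hv

/-! ### Symmetries -/

/-- The isometry of `ℝ³` which permutes the coordinates cyclically and then changes their signs.
These maps are symmetries of the Euclidean dodecahedron and act transitively on its faces. -/
def signedShift (ε : Fin 3 → ℤˣ) (i : Fin 3) : (Fin 3 → ℝ) ≃ₗ[ℝ] (Fin 3 → ℝ) where
  toFun y j := ε j • y (j - i)
  invFun y j := ε (j + i) • y (j + i)
  map_add' x y := by ext j; exact smul_add _ _ _
  map_smul' c y := by ext j; exact smul_comm (ε j) c (y (j - i))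
  left_inv y := by
    ext j
    simp only [smul_smul, Int.units_mul_self, one_smul, add_sub_cancel_right]
  right_inv y := by
    ext j
    simp only [smul_smul, Int.units_mul_self, one_smul, sub_add_cancel]

section SignedShift

variable (ε : Fin 3 → ℤˣ) (i : Fin 3)

theorem signedShift_apply (y : Fin 3 → ℝ) (j : Fin 3) :
    signedShift ε i y j = ε j • y (j - i) := rfl

theorem abs_units_smul (s : ℤˣ) (a : ℝ) : |s • a| = |a| := by
  rcases Int.units_eq_one_or s with rfl | rfl
  · rw [one_smul]
  · rw [Units.neg_smul, one_smul, abs_neg]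

theorem exists_eq_units_smul_abs (a : ℝ) : ∃ s : ℤˣ, a = s • |a| := by
  rcases eq_or_eq_neg_of_abs_eq (rfl : |a| = |a|) with h | h
  · exact ⟨1, by rwa [one_smul]⟩
  · exact ⟨-1, by rwa [Units.neg_smul, one_smul]⟩

theorem dotProduct_signedShift (x y : Fin 3 → ℝ) :
    signedShift ε i x ⬝ᵥ signedShift ε i y = x ⬝ᵥ y := by
  calc signedShift ε i x ⬝ᵥ signedShift ε i y = ∑ j, x (j - i) * y (j - i) :=
        Finset.sum_congr rfl fun j _ => by
          rw [signedShift_apply, signedShift_apply, smul_mul_smul_comm, Int.units_mul_self,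
            one_smul]
    _ = x ⬝ᵥ y := Equiv.sum_comp (Equiv.subRight i) fun j => x j * y j

theorem dotProduct_signedShift_left (x y : Fin 3 → ℝ) :
    signedShift ε i x ⬝ᵥ y = x ⬝ᵥ (signedShift ε i).symm y := by
  rw [← dotProduct_signedShift ε i x, LinearEquiv.apply_symm_apply]

variable {ε i}

theorem signedShift_mem_euclVertices_iff {v : Fin 3 → ℝ} :
    signedShift ε i v ∈ euclVertices ↔ v ∈ euclVertices := by
  refine or_congr ((Equiv.subRight i).forall_congr fun j => ?_)
    ((Equiv.subRight i).exists_congr fun j => ?_)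
  · rw [signedShift_apply, abs_units_smul]; rfl
  · simp only [signedShift_apply, abs_units_smul, smul_eq_zero_iff_eq, Equiv.subRight_apply,
      add_sub_right_comm]

theorem signedShift_mem_euclNormals_iff {n : Fin 3 → ℝ} :
    signedShift ε i n ∈ euclNormals ↔ n ∈ euclNormals := by
  refine (Equiv.subRight i).exists_congr fun j => ?_
  simp only [signedShift_apply, abs_units_smul, smul_eq_zero_iff_eq, Equiv.subRight_apply,
    add_sub_right_comm]

theorem symm_signedShift_mem_euclVertices {v : Fin 3 → ℝ} (hv : v ∈ euclVertices) :
    (signedShift ε i).symm v ∈ euclVertices := by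
  rwa [← signedShift_mem_euclVertices_iff (ε := ε) (i := i), LinearEquiv.apply_symm_apply]

theorem symm_signedShift_mem_euclNormals {n : Fin 3 → ℝ} (hn : n ∈ euclNormals) :
    (signedShift ε i).symm n ∈ euclNormals := by
  rwa [← signedShift_mem_euclNormals_iff (ε := ε) (i := i), LinearEquiv.apply_symm_apply]

variable (i) in
theorem exists_eq_signedShift (y : Fin 3 → ℝ) :
    ∃ ε, y = signedShift ε i fun j => |y (i + j)| := by
  choose s hs using exists_eq_units_smul_abs
  refine ⟨fun j => s (y j), ?_⟩
  ext j
  rw [signedShift_apply, add_sub_cancel, ← hs]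

end SignedShift

/-- The normal vector `(0, 1, φ)`, to whose face the others are reduced by symmetry. -/
def baseNormal : Fin 3 → ℝ := ![0, 1, φ]

theorem baseNormal_mem : baseNormal ∈ euclNormals :=
  ⟨0, rfl, abs_one, abs_of_pos goldenRatio_pos⟩

theorem baseNormal_dotProduct (v : Fin 3 → ℝ) : baseNormal ⬝ᵥ v = v 1 + φ * v 2 := by
  rw [baseNormal, Matrix.vec3_dotProduct]
  simp

theorem exists_signedShift_baseNormal {n : Fin 3 → ℝ} (hn : n ∈ euclNormals) :
    ∃ ε i, n = signedShift ε i baseNormal := by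
  obtain ⟨i, h0, h1, h2⟩ := hn
  obtain ⟨ε, hε⟩ := exists_eq_signedShift i n
  have habs : (fun j => |n (i + j)|) = baseNormal := by
    ext j
    fin_cases j
    exacts [by simpa [baseNormal] using h0, h1, h2]
  exact ⟨ε, i, habs ▸ hε⟩

theorem dotProduct_le_goldenRatio_sq {n v : Fin 3 → ℝ} (hn : n ∈ euclNormals)
    (hv : v ∈ euclVertices) : n ⬝ᵥ v ≤ φ ^ 2 := by
  obtain ⟨ε, i, rfl⟩ := exists_signedShift_baseNormal hn
  rw [dotProduct_signedShift_left, baseNormal_dotProduct]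
  have hw := symm_signedShift_mem_euclVertices (ε := ε) (i := i) hv
  generalize (signedShift ε i).symm v = w at hw
  have hle1 := le_abs_self (w 1)
  have hle2 := mul_le_mul_of_nonneg_left (le_abs_self (w 2)) goldenRatio_pos.le
  rcases mem_euclVertices_iff.1 hw with
    ⟨-, h1, h2⟩ | ⟨-, h1, h2⟩ | ⟨h1, h2, -⟩ | ⟨h2, -, h1⟩ <;>
    simp only [h1, h2, abs_zero, mul_zero] at hle1 hle2 ⊢ <;>
    linarith [goldenRatio_sq, one_lt_goldenRatio]

theorem dotProduct_trichotomy_of_mem_euclNormals {n m : Fin 3 → ℝ} (hn : n ∈ euclNormals)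
    (hm : m ∈ euclNormals) : n ⬝ᵥ m = φ + 2 ∨ n ⬝ᵥ m = φ ∨ n ⬝ᵥ m ≤ -φ := by
  obtain ⟨ε, i, rfl⟩ := exists_signedShift_baseNormal hn
  rw [dotProduct_signedShift_left, baseNormal_dotProduct]
  have hw := symm_signedShift_mem_euclNormals (ε := ε) (i := i) hm
  generalize (signedShift ε i).symm m = w at hw
  have hφ := goldenRatio_sq
  rcases mem_euclNormals_iff.1 hw with ⟨-, h1, h2⟩ | ⟨h1, h2, -⟩ | ⟨h2, -, h1⟩
  · rcases eq_or_eq_neg_of_abs_eq h1 with h1 | h1 <;>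
      rcases eq_or_eq_neg_of_abs_eq h2 with h2 | h2 <;> rw [h1, h2]
    exacts [.inl (by linarith), .inr (.inr (by linarith)), .inr (.inl (by linarith)),
      .inr (.inr (by linarith [one_lt_goldenRatio]))]
  · rcases eq_or_eq_neg_of_abs_eq h2 with h2 | h2 <;> rw [h1, h2]
    exacts [.inr (.inl (by ring)), .inr (.inr (by linarith))]
  · rcases eq_or_eq_neg_of_abs_eq h1 with h1 | h1 <;> rw [h1, h2]
    exacts [.inr (.inl (by ring)), .inr (.inr (by linarith))]

theorem dotProduct_eq_goldenRatio_of_common_vertex {n m v : Fin 3 → ℝ} (hn : n ∈ euclNormals)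
    (hm : m ∈ euclNormals) (hv : v ∈ euclVertices) (hnm : n ≠ m) (hnv : n ⬝ᵥ v = φ ^ 2)
    (hmv : m ⬝ᵥ v = φ ^ 2) : n ⬝ᵥ m = φ := by
  have hnn := dotProduct_self_of_mem_euclNormals hn
  have hmm := dotProduct_self_of_mem_euclNormals hm
  have hne : n ⬝ᵥ m ≠ φ + 2 := fun h => hnm (eq_of_dotProduct_eq_self hnn hmm h)
  refine ((dotProduct_trichotomy_of_mem_euclNormals hn hm).resolve_left hne).resolve_right
    fun h => ?_
  -- in the remaining case the vectors `n + m` and `v` violate the Cauchy–Schwarz inequality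
  have hsq : 0 ≤ (n + m - (2 : ℝ) • v) ⬝ᵥ (n + m - (2 : ℝ) • v) :=
    dotProduct_self_nonneg _
  simp only [sub_dotProduct, dotProduct_sub, add_dotProduct, dotProduct_add, smul_dotProduct,
    dotProduct_smul, smul_eq_mul, dotProduct_comm v, hnv, hmv, hnn, hmm, dotProduct_comm m n,
    dotProduct_self_of_mem_euclVertices hv] at hsq
  linarith [goldenRatio_sq, one_lt_goldenRatio]

/-! ### The pentagons -/

/-- The vertices of the face with normal `(0, 1, φ)` in cyclic order. -/
def basePentagon : Fin 5 → Fin 3 → ℝ :=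
  ![![1, 1, 1], ![0, φ, φ - 1], ![-1, 1, 1], ![1 - φ, 0, φ], ![φ - 1, 0, φ]]

/-- The normal vectors of the faces adjacent to the face with normal `(0, 1, φ)`; the `i`-th one
meets it in the side from the `i`-th to the `i + 1`-st vertex. -/
def baseNeighbour : Fin 5 → Fin 3 → ℝ :=
  ![![1, φ, 0], ![-1, φ, 0], ![-φ, 0, 1], ![0, -1, φ], ![φ, 0, 1]]

/-- `p` lists the vertices of the face with normal `n` in cyclic order, and `m i` is the normal of
the face on the other side of the edge from `p i` to `p (i + 1)`. -/
structure IsPentagon (n : Fin 3 → ℝ) (p m : Fin 5 → Fin 3 → ℝ) : Prop where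
  mem_vertices : ∀ i, p i ∈ euclVertices
  mem_normals : ∀ i, m i ∈ euclNormals
  dotProduct_eq : ∀ i, n ⬝ᵥ p i = φ ^ 2
  mem_range : ∀ v ∈ euclVertices, n ⬝ᵥ v = φ ^ 2 → v ∈ Set.range p
  neighbour_iff : ∀ i j, m i ⬝ᵥ p j = φ ^ 2 ↔ j = i ∨ j = i + 1
  dotProduct_succ : ∀ i, p i ⬝ᵥ p (i + 1) = 2 * φ - 1
  dotProduct_pred_succ : ∀ i, p (i - 1) ⬝ᵥ p (i + 1) = 1

theorem basePentagon_mem (i : Fin 5) : basePentagon i ∈ euclVertices := by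
  have h := abs_of_pos goldenRatio_pos
  have h' := abs_of_pos (sub_pos.2 one_lt_goldenRatio)
  rw [mem_euclVertices_iff]
  fin_cases i <;> simp [basePentagon, h, h', abs_sub_comm 1 φ]

theorem baseNeighbour_mem (i : Fin 5) : baseNeighbour i ∈ euclNormals := by
  have h := abs_of_pos goldenRatio_pos
  rw [mem_euclNormals_iff]
  fin_cases i <;> simp [baseNeighbour, h]

theorem baseNormal_dotProduct_basePentagon (i : Fin 5) :
    baseNormal ⬝ᵥ basePentagon i = φ ^ 2 := by
  rw [baseNormal_dotProduct]
  fin_cases i <;> simp only [basePentagon, Fin.zero_eta, Fin.mk_one, Fin.reduceFinMk,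
    Matrix.cons_val] <;> linarith [goldenRatio_sq]

theorem mem_range_basePentagon {v : Fin 3 → ℝ} (hv : v ∈ euclVertices)
    (h : baseNormal ⬝ᵥ v = φ ^ 2) : v ∈ Set.range basePentagon := by
  have hφ := goldenRatio_sq
  have hφ1 := one_lt_goldenRatio
  have eq_vec (a b c : ℝ) (h0 : v 0 = a) (h1 : v 1 = b) (h2 : v 2 = c) : ![a, b, c] = v := by
    subst h0 h1 h2
    ext j
    fin_cases j <;> rfl
  rw [baseNormal_dotProduct] at h
  rcases mem_euclVertices_iff.1 hv with
    ⟨h0, h1, h2⟩ | ⟨h0, h1, h2⟩ | ⟨h1, -, h0⟩ | ⟨h2, h0, h1⟩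
  · have h1' : v 1 = 1 := (eq_or_eq_neg_of_abs_eq h1).resolve_right fun h' => by
      rcases eq_or_eq_neg_of_abs_eq h2 with h2 | h2 <;> rw [h', h2] at h <;> linarith
    have h2' : v 2 = 1 := mul_left_cancel₀ goldenRatio_ne_zero (by linarith)
    rcases eq_or_eq_neg_of_abs_eq h0 with h0 | h0
    exacts [⟨0, eq_vec _ _ _ h0 h1' h2'⟩, ⟨2, eq_vec _ _ _ h0 h1' h2'⟩]
  · have h1' : v 1 = φ := (eq_or_eq_neg_of_abs_eq h1).resolve_right fun h' => by
      rcases eq_or_eq_neg_of_abs_eq h2 with h2 | h2 <;> rw [h', h2] at h <;> linarith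
    have h2' : v 2 = φ - 1 := mul_left_cancel₀ goldenRatio_ne_zero (by linarith)
    exact ⟨1, eq_vec _ _ _ h0 h1' h2'⟩
  · have h2' : v 2 = φ := mul_left_cancel₀ goldenRatio_ne_zero (by linarith)
    rcases eq_or_eq_neg_of_abs_eq h0 with h0 | h0
    exacts [⟨4, eq_vec _ _ _ h0 h1 h2'⟩, ⟨3, eq_vec _ _ _ (by linarith) h1 h2'⟩]
  · rcases eq_or_eq_neg_of_abs_eq h1 with h1 | h1 <;> rw [h1, h2] at h <;> linarith

theorem baseNeighbour_dotProduct_eq_iff (i j : Fin 5) :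
    baseNeighbour i ⬝ᵥ basePentagon j = φ ^ 2 ↔ j = i ∨ j = i + 1 := by
  rw [Matrix.vec3_dotProduct]
  fin_cases i <;> fin_cases j <;> simp only [baseNeighbour, basePentagon, Fin.zero_eta,
    Fin.mk_one, Fin.reduceFinMk, Fin.reduceAdd, Fin.reduceEq, Matrix.cons_val, or_false, or_true,
    or_self, iff_true, iff_false] <;>
    linarith [goldenRatio_sq, eight_fifths_lt_goldenRatio]

theorem basePentagon_dotProduct_succ (i : Fin 5) :
    basePentagon i ⬝ᵥ basePentagon (i + 1) = 2 * φ - 1 := by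
  rw [Matrix.vec3_dotProduct]
  fin_cases i <;> simp only [basePentagon, Fin.zero_eta, Fin.mk_one, Fin.reduceFinMk, Fin.reduceAdd,
    Matrix.cons_val] <;> linarith [goldenRatio_sq]

theorem basePentagon_dotProduct_pred_succ (i : Fin 5) :
    basePentagon (i - 1) ⬝ᵥ basePentagon (i + 1) = 1 := by
  rw [Matrix.vec3_dotProduct]
  fin_cases i <;> simp only [basePentagon, Fin.zero_eta, Fin.mk_one, Fin.reduceFinMk, Fin.reduceAdd,
    Fin.reduceSub, Matrix.cons_val] <;> linarith [goldenRatio_sq]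

theorem isPentagon_baseNormal : IsPentagon baseNormal basePentagon baseNeighbour where
  mem_vertices := basePentagon_mem
  mem_normals := baseNeighbour_mem
  dotProduct_eq := baseNormal_dotProduct_basePentagon
  mem_range _ := mem_range_basePentagon
  neighbour_iff := baseNeighbour_dotProduct_eq_iff
  dotProduct_succ := basePentagon_dotProduct_succ
  dotProduct_pred_succ := basePentagon_dotProduct_pred_succ

section Pentagon

variable {n : Fin 3 → ℝ} {p m : Fin 5 → Fin 3 → ℝ}

theorem IsPentagon.signedShift (h : IsPentagon n p m) (ε : Fin 3 → ℤˣ) (i : Fin 3) :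
    IsPentagon (signedShift ε i n) (signedShift ε i ∘ p) (signedShift ε i ∘ m) where
  mem_vertices j := signedShift_mem_euclVertices_iff.2 (h.mem_vertices j)
  mem_normals j := signedShift_mem_euclNormals_iff.2 (h.mem_normals j)
  dotProduct_eq j := (dotProduct_signedShift ε i n (p j)).trans (h.dotProduct_eq j)
  mem_range v hv hnv := by
    rw [dotProduct_signedShift_left] at hnv
    obtain ⟨j, hj⟩ := h.mem_range _ (symm_signedShift_mem_euclVertices hv) hnv
    exact ⟨j, by rw [Function.comp_apply, hj, LinearEquiv.apply_symm_apply]⟩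
  neighbour_iff j k := by
    rw [Function.comp_apply, Function.comp_apply, dotProduct_signedShift, h.neighbour_iff]
  dotProduct_succ j := (dotProduct_signedShift ε i _ _).trans (h.dotProduct_succ j)
  dotProduct_pred_succ j := (dotProduct_signedShift ε i _ _).trans (h.dotProduct_pred_succ j)

theorem exists_isPentagon (hn : n ∈ euclNormals) : ∃ p m, IsPentagon n p m := by
  obtain ⟨ε, i, rfl⟩ := exists_signedShift_baseNormal hn
  exact ⟨_, _, isPentagon_baseNormal.signedShift ε i⟩

theorem IsPentagon.injective (h : IsPentagon n p m) : Function.Injective p := by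
  have separated : ∀ j k : Fin 5, (∀ i, (j = i ∨ j = i + 1) ↔ (k = i ∨ k = i + 1)) → j = k := by
    decide
  exact fun j k hjk => separated j k fun i => by rw [← h.neighbour_iff, ← h.neighbour_iff, hjk]

end Pentagon

/-! ### The dodecahedron as a convex hull -/

section Cone

variable {K : PointedCone ℝ (ℝ × (Fin 3 → ℝ))} {h : ℝ} {z : Fin 3 → ℝ}

theorem one_zero_mem (hK : ∀ v ∈ euclVertices, ((1 : ℝ), v) ∈ K) :
    ((1 : ℝ), (0 : Fin 3 → ℝ)) ∈ K := by
  have h0 := basePentagon_mem 0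
  convert K.smul_mem (r := 1 / 2) (by norm_num)
    (K.add_mem (hK _ h0) (hK _ (neg_mem_euclVertices h0))) using 1
  ext <;> norm_num

theorem one_midpoint_mem (hK : ∀ v ∈ euclVertices, ((1 : ℝ), v) ∈ K) :
    ((1 : ℝ), (![0, 0, φ] : Fin 3 → ℝ)) ∈ K := by
  convert K.smul_mem (r := 1 / 2) (by norm_num)
    (K.add_mem (hK _ (basePentagon_mem 3)) (hK _ (basePentagon_mem 4))) using 1
  ext j
  · norm_num
  · fin_cases j <;> simp only [basePentagon, Prod.snd_add, Prod.smul_snd, Pi.add_apply,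
      Pi.smul_apply, smul_eq_mul, Fin.zero_eta, Fin.mk_one, Fin.reduceFinMk, Matrix.cons_val] <;>
      ring

theorem height_nonneg (hh : z 1 + φ * z 2 ≤ φ ^ 2 * h) : 0 ≤ h - (2 - φ) * (z 1 + φ * z 2) := by
  have hφ : (2 - φ) * φ ^ 2 = 1 := by linear_combination (1 - φ) * goldenRatio_sq
  have hle := mul_le_mul_of_nonneg_left hh (sub_nonneg.2 goldenRatio_lt_two.le)
  rwa [← mul_assoc, hφ, one_mul, ← sub_nonneg] at hle

/-- Such a point lies in the simplicial cone spanned by the centre of the dodecahedron, the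
midpoint `(0, 0, φ)` of an edge, the end of that edge in the plane `x 1 = 0` and `(1, 1, 1)`. -/
theorem mem_of_coord_one_le_coord_zero (hK : ∀ v ∈ euclVertices, ((1 : ℝ), v) ∈ K)
    (hz : 0 ≤ z 1) (hle : z 1 ≤ z 0) (hh : z 1 + φ * z 2 ≤ φ ^ 2 * h)
    (hmax : z 2 + φ * z 0 ≤ z 1 + φ * z 2) : (h, z) ∈ K := by
  have hmid : 0 ≤ (φ - 1) * (z 2 - z 1) - φ * (z 0 - z 1) := by linarith
  convert K.add_mem (K.add_mem (K.add_mem (K.smul_mem hmid (one_midpoint_mem hK))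
    (K.smul_mem (mul_nonneg goldenRatio_pos.le (sub_nonneg.2 hle)) (hK _ (basePentagon_mem 4))))
    (K.smul_mem hz (hK _ (basePentagon_mem 0)))) (K.smul_mem (height_nonneg hh) (one_zero_mem hK))
    using 1
  ext j
  · simp only [Prod.fst_add, Prod.smul_fst, smul_eq_mul]
    linear_combination (-z 2) * goldenRatio_sq
  · fin_cases j <;> simp only [basePentagon, Prod.snd_add, Prod.smul_snd, Pi.add_apply,
      Pi.smul_apply, smul_eq_mul, Pi.zero_apply, Fin.zero_eta, Fin.mk_one, Fin.reduceFinMk,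
      Matrix.cons_val]
    · linear_combination (z 1 - z 0) * goldenRatio_sq
    · ring
    · linear_combination (z 1 - z 2) * goldenRatio_sq

theorem mem_of_coord_zero_le_coord_one (hK : ∀ v ∈ euclVertices, ((1 : ℝ), v) ∈ K)
    (hz : 0 ≤ z 0) (hle : z 0 ≤ z 1) (hh : z 1 + φ * z 2 ≤ φ ^ 2 * h)
    (hmax : z 0 + φ * z 1 ≤ z 1 + φ * z 2) : (h, z) ∈ K := by
  have hφ1 := (sub_pos.2 one_lt_goldenRatio).le
  have hmid : 0 ≤ (φ - 1) * (z 2 - z 0 - (2 - φ) * (z 1 - z 0)) :=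
    mul_nonneg hφ1 (by nlinarith [goldenRatio_sq])
  convert K.add_mem (K.add_mem (K.add_mem (K.smul_mem hmid (one_midpoint_mem hK))
    (K.smul_mem (mul_nonneg hφ1 (sub_nonneg.2 hle)) (hK _ (basePentagon_mem 1))))
    (K.smul_mem hz (hK _ (basePentagon_mem 0)))) (K.smul_mem (height_nonneg hh) (one_zero_mem hK))
    using 1
  ext j
  · simp only [Prod.fst_add, Prod.smul_fst, smul_eq_mul]
    linear_combination (z 0 - z 1 - z 2) * goldenRatio_sq
  · fin_cases j <;> simp only [basePentagon, Prod.snd_add, Prod.smul_snd, Pi.add_apply,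
      Pi.smul_apply, smul_eq_mul, Pi.zero_apply, Fin.zero_eta, Fin.mk_one, Fin.reduceFinMk,
      Matrix.cons_val]
    · ring
    · linear_combination (z 0 - z 1) * goldenRatio_sq
    · linear_combination (z 0 - z 2 + (1 - φ) * (z 1 - z 0)) * goldenRatio_sq

/-- Homogeneous form of the statement that the dodecahedron is the convex hull of its vertices. By
symmetry it suffices to consider a point in the positive octant for which the face with normal
`(0, 1, φ)` gives the strongest of the inequalities. -/
theorem mem_of_forall_dotProduct_le (hK : ∀ v ∈ euclVertices, ((1 : ℝ), v) ∈ K) {y : Fin 3 → ℝ}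
    (hy : ∀ n ∈ euclNormals, n ⬝ᵥ y ≤ φ ^ 2 * h) : (h, y) ∈ K := by
  obtain ⟨i, hi⟩ := Finite.exists_max fun i : Fin 3 => |y (i + 1)| + φ * |y (i + 2)|
  obtain ⟨ε, hε⟩ := exists_eq_signedShift i y
  set z : Fin 3 → ℝ := fun j => |y (i + j)|
  have hmax0 : z 2 + φ * z 0 ≤ z 1 + φ * z 2 := by simpa [z, add_assoc] using hi (i + 1)
  have hmax1 : z 0 + φ * z 1 ≤ z 1 + φ * z 2 := by simpa [z, add_assoc] using hi (i + 2)
  have hh : z 1 + φ * z 2 ≤ φ ^ 2 * h := by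
    have hle := hy (signedShift ε i baseNormal) (signedShift_mem_euclNormals_iff.2 baseNormal_mem)
    rwa [hε, dotProduct_signedShift, baseNormal_dotProduct] at hle
  let K' := K.comap (LinearMap.prodMap LinearMap.id (signedShift ε i).toLinearMap)
  have hK' : ∀ v ∈ euclVertices, ((1 : ℝ), v) ∈ K' :=
    fun v hv => hK _ (signedShift_mem_euclVertices_iff.2 hv)
  rw [hε]
  change (h, z) ∈ K'
  rcases le_total (z 1) (z 0) with hle | hle
  · exact mem_of_coord_one_le_coord_zero hK' (abs_nonneg _) hle hh hmax0
  · exact mem_of_coord_zero_le_coord_one hK' (abs_nonneg _) hle hh hmax1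

end Cone

/-! ### The hyperbolic dodecahedron -/

theorem form_vecCons (a b : ℝ) (x y : Fin 3 → ℝ) :
    form (Matrix.vecCons a x) (Matrix.vecCons b y) = x ⬝ᵥ y - a * b := by
  rw [Matrix.vec3_dotProduct]
  change -(a * b) + x 0 * y 0 + x 1 * y 1 + x 2 * y 2 = _
  ring

/-- The outer normal of the hyperbolic face corresponding to the Euclidean normal `n`. The time
coordinate makes the normals of adjacent faces, whose Euclidean product is `φ`, orthogonal. -/
def normalVec (n : Fin 3 → ℝ) : Fin 4 → ℝ := Matrix.vecCons (√φ) n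

/-- The linear map from the cone over the Euclidean dodecahedron, whose points at height `h` form
its dilation by `h`, to the cone over the hyperbolic one. The factor `√(φ / 2)` makes it send
`(1, v)` to the hyperboloid for the vertices `v`. -/
def coneMap : (ℝ × (Fin 3 → ℝ)) →ₗ[ℝ] (Fin 4 → ℝ) where
  toFun q := √(φ / 2) • Matrix.vecCons (√φ * φ * q.1) q.2
  map_add' p q := by
    rw [← smul_add, Matrix.cons_add_cons, Prod.fst_add, Prod.snd_add, mul_add]
  map_smul' c q := by
    rw [RingHom.id_apply, smul_comm c, Matrix.smul_cons c, Prod.smul_fst, Prod.smul_snd,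
      smul_eq_mul, smul_eq_mul, mul_left_comm]

theorem coneMap_apply (h : ℝ) (y : Fin 3 → ℝ) :
    coneMap (h, y) = √(φ / 2) • Matrix.vecCons (√φ * φ * h) y := rfl

theorem sqrt_goldenRatio_mul_self : √φ * √φ = φ := Real.mul_self_sqrt goldenRatio_pos.le

theorem sqrt_half_goldenRatio_pos : 0 < √(φ / 2) := Real.sqrt_pos.2 (half_pos goldenRatio_pos)

theorem coneMap_surjective : Function.Surjective coneMap := by
  intro x
  have hs := sqrt_half_goldenRatio_pos.ne'
  have hc : √φ * φ ≠ 0 := mul_ne_zero (Real.sqrt_pos.2 goldenRatio_pos).ne' goldenRatio_ne_zero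
  refine ⟨((√φ * φ)⁻¹ * (√(φ / 2))⁻¹ * x 0, (√(φ / 2))⁻¹ • Matrix.vecTail x), ?_⟩
  rw [coneMap_apply, Matrix.smul_cons, smul_inv_smul₀ hs, smul_eq_mul, mul_assoc (√φ * φ)⁻¹,
    mul_inv_cancel_left₀ hc, mul_inv_cancel_left₀ hs]
  exact Matrix.cons_head_tail x

theorem form_normalVec_coneMap (n : Fin 3 → ℝ) (h : ℝ) (y : Fin 3 → ℝ) :
    form (normalVec n) (coneMap (h, y)) = √(φ / 2) * (n ⬝ᵥ y - φ ^ 2 * h) := by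
  rw [coneMap_apply, form_smul_right, normalVec, form_vecCons]
  linear_combination (-√(φ / 2) * φ * h) * sqrt_goldenRatio_mul_self

theorem form_normalVec_normalVec (n m : Fin 3 → ℝ) :
    form (normalVec n) (normalVec m) = n ⬝ᵥ m - φ := by
  rw [normalVec, normalVec, form_vecCons, sqrt_goldenRatio_mul_self]

theorem form_coneMap_coneMap (h k : ℝ) (x y : Fin 3 → ℝ) :
    form (coneMap (h, x)) (coneMap (k, y)) = φ / 2 * (x ⬝ᵥ y - φ ^ 3 * (h * k)) := by
  rw [coneMap_apply, coneMap_apply, form_smul_left, form_smul_right, form_vecCons, ← mul_assoc,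
    Real.mul_self_sqrt (half_pos goldenRatio_pos).le]
  linear_combination (-φ / 2 * φ * h * φ * k) * sqrt_goldenRatio_mul_self

theorem form_normalVec_coneMap_nonpos_iff {n : Fin 3 → ℝ} {h : ℝ} {y : Fin 3 → ℝ} :
    form (normalVec n) (coneMap (h, y)) ≤ 0 ↔ n ⬝ᵥ y ≤ φ ^ 2 * h := by
  rw [form_normalVec_coneMap, ← smul_eq_mul, smul_nonpos_iff_nonpos_of_pos_left
    sqrt_half_goldenRatio_pos, sub_nonpos]

theorem form_normalVec_self_pos {n : Fin 3 → ℝ} (hn : n ∈ euclNormals) :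
    0 < form (normalVec n) (normalVec n) := by
  rw [form_normalVec_normalVec, dotProduct_self_of_mem_euclNormals hn]
  linarith

/-- The hyperbolic vertex corresponding to the Euclidean vertex `v`. -/
def vertex (v : euclVertices) : H3 :=
  ⟨coneMap (1, v.1), by
    rw [form_coneMap_coneMap, dotProduct_self_of_mem_euclVertices v.2, goldenRatio_pow_three]
    linarith [goldenRatio_sq],
    mul_pos sqrt_half_goldenRatio_pos
      (mul_pos (mul_pos (Real.sqrt_pos.2 goldenRatio_pos) goldenRatio_pos) one_pos)⟩

theorem vertex_val (v : euclVertices) : (vertex v).1 = coneMap (1, v.1) := rfl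

theorem vertex_injective : Function.Injective vertex := by
  intro v w hvw
  have h := (vertex v).2.1
  nth_rw 2 [hvw] at h
  rw [vertex_val, vertex_val, form_coneMap_coneMap, goldenRatio_pow_three] at h
  have hdot : φ * (v.1 ⬝ᵥ w.1) = φ * 3 := by linear_combination 2 * h + 2 * goldenRatio_sq
  exact Subtype.ext (eq_of_dotProduct_eq_self (dotProduct_self_of_mem_euclVertices v.2)
    (dotProduct_self_of_mem_euclVertices w.2) (mul_left_cancel₀ goldenRatio_ne_zero hdot))

theorem vertex_mem_plane_iff {v : euclVertices} {n : Fin 3 → ℝ} :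
    vertex v ∈ plane (normalVec n) ↔ n ⬝ᵥ v.1 = φ ^ 2 := by
  change form (normalVec n) (coneMap (1, v.1)) = 0 ↔ _
  rw [form_normalVec_coneMap, mul_eq_zero, or_iff_right sqrt_half_goldenRatio_pos.ne', mul_one,
    sub_eq_zero]

theorem range_vertex_subset_halfSpace {n : Fin 3 → ℝ} (hn : n ∈ euclNormals) :
    Set.range vertex ⊆ halfSpace (normalVec n) := by
  rintro _ ⟨v, rfl⟩
  refine form_normalVec_coneMap_nonpos_iff.2 ?_
  rw [mul_one]
  exact dotProduct_le_goldenRatio_sq hn v.2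

/-- The right-angled regular hyperbolic dodecahedron. -/
def dodecahedron : Set H3 := polyhedron (normalVec '' euclNormals)

theorem dodecahedron_subset_halfSpace {n : Fin 3 → ℝ} (hn : n ∈ euclNormals) :
    dodecahedron ⊆ halfSpace (normalVec n) :=
  Set.biInter_subset_of_mem (Set.mem_image_of_mem _ hn)

theorem dodecahedron_eq_hull : dodecahedron = hull (Set.range vertex) := by
  refine Set.Subset.antisymm (fun x hx => mem_hull_iff.2 ?_)
    (hull_subset (isConvex_polyhedron _) fun x hx => mem_polyhedron.2 ?_)
  · obtain ⟨⟨h, y⟩, hy⟩ := coneMap_surjective x.1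
    rw [← hy]
    refine mem_of_forall_dotProduct_le (K := (coneSpan (Set.range vertex)).comap coneMap)
      (fun v hv => mem_coneSpan (x := vertex ⟨v, hv⟩) ⟨_, rfl⟩) fun n hn => ?_
    rw [← form_normalVec_coneMap_nonpos_iff, hy]
    exact dodecahedron_subset_halfSpace hn hx
  · rintro _ ⟨n, hn, rfl⟩
    exact range_vertex_subset_halfSpace hn hx

theorem isCompact_dodecahedron : IsCompact dodecahedron := by
  rw [dodecahedron_eq_hull]
  have hbdd : BddAbove ((fun x : H3 => x.1 0) '' Set.range vertex) := by
    refine ⟨√(φ / 2) * (√φ * φ * 1), ?_⟩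
    rintro _ ⟨_, ⟨v, rfl⟩, rfl⟩
    exact le_rfl
  exact isCompact_hull hbdd (dodecahedron_eq_hull ▸ isClosed_polyhedron _)

theorem nonempty_interior_dodecahedron : (interior dodecahedron).Nonempty := by
  refine ⟨⟨![1, 0, 0, 0], by simp [form], by simp⟩,
    mem_interior_polyhedron (finite_euclNormals.image _) ?_⟩
  rintro _ ⟨n, -, rfl⟩
  change -(√φ * 1) + n 0 * 0 + n 1 * 0 + n 2 * 0 < 0
  linarith [Real.sqrt_pos.2 goldenRatio_pos]

theorem isConvexPolyhedron_dodecahedron : IsConvexPolyhedron dodecahedron where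
  isConvex := isConvex_polyhedron _
  isCompact := isCompact_dodecahedron
  nonempty_interior := nonempty_interior_dodecahedron
  eq_inter := ⟨normalVec '' euclNormals, finite_euclNormals.image _,
    Set.forall_mem_image.2 fun _ => form_normalVec_self_pos, rfl⟩

/-- A normal of the plane through `vertex v` which supports the dodecahedron at that vertex only
and is orthogonal to the line from the centre. -/
def vertexNormal (v : euclVertices) : Fin 4 → ℝ := coneMap (3, φ ^ 3 • v.1)

theorem form_vertexNormal_vertex (v w : euclVertices) :
    form (vertexNormal v) (vertex w).1 = φ ^ 4 / 2 * (v.1 ⬝ᵥ w.1 - 3) := by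
  rw [vertexNormal, vertex_val, form_coneMap_coneMap, smul_dotProduct, smul_eq_mul]
  ring

theorem form_vertexNormal_self_pos (v : euclVertices) :
    0 < form (vertexNormal v) (vertexNormal v) := by
  have hφ3 : 3 < φ ^ 3 := by rw [goldenRatio_pow_three]; linarith [one_lt_goldenRatio]
  rw [vertexNormal, form_coneMap_coneMap, smul_dotProduct, dotProduct_smul,
    dotProduct_self_of_mem_euclVertices v.2, smul_eq_mul, smul_eq_mul]
  exact mul_pos (half_pos goldenRatio_pos) (by nlinarith)

theorem range_vertex_subset_halfSpace_vertexNormal (v : euclVertices) :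
    Set.range vertex ⊆ halfSpace (vertexNormal v) := by
  rintro _ ⟨w, rfl⟩
  have hle : v.1 ⬝ᵥ w.1 ≤ 3 := dotProduct_le_of_dotProduct_self_eq
    (dotProduct_self_of_mem_euclVertices v.2) (dotProduct_self_of_mem_euclVertices w.2)
  change form (vertexNormal v) (vertex w).1 ≤ 0
  rw [form_vertexNormal_vertex]
  exact mul_nonpos_of_nonneg_of_nonpos (by positivity) (sub_nonpos.2 hle)

theorem range_vertex_inter_plane_vertexNormal (v : euclVertices) :
    Set.range vertex ∩ plane (vertexNormal v) = {vertex v} := by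
  have hv := dotProduct_self_of_mem_euclVertices v.2
  have hpos : φ ^ 4 / 2 ≠ 0 := by positivity
  refine Set.Subset.antisymm ?_ (Set.singleton_subset_iff.2 ⟨⟨v, rfl⟩, ?_⟩)
  · rintro _ ⟨⟨w, rfl⟩, hw : form (vertexNormal v) (vertex w).1 = 0⟩
    rw [form_vertexNormal_vertex, mul_eq_zero, or_iff_right hpos, sub_eq_zero] at hw
    have hvw := eq_of_dotProduct_eq_self hv (dotProduct_self_of_mem_euclVertices w.2) hw
    exact congrArg vertex (Subtype.ext hvw.symm)
  · change form (vertexNormal v) (vertex v).1 = 0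
    rw [form_vertexNormal_vertex, hv, sub_self, mul_zero]

theorem isVertex_dodecahedron_iff {x : H3} : IsVertex dodecahedron x ↔ x ∈ Set.range vertex := by
  rw [dodecahedron_eq_hull]
  refine ⟨IsVertex.mem_of_hull, ?_⟩
  rintro ⟨v, rfl⟩
  exact isVertex_hull (form_vertexNormal_self_pos v) (range_vertex_subset_halfSpace_vertexNormal v)
    (range_vertex_inter_plane_vertexNormal v)

/-- The face of the hyperbolic dodecahedron with outer normal `normalVec n`. -/
def facet (n : Fin 3 → ℝ) : Set H3 := dodecahedron ∩ plane (normalVec n)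

theorem facet_eq_hull {n : Fin 3 → ℝ} (hn : n ∈ euclNormals) :
    facet n = hull (Set.range vertex ∩ plane (normalVec n)) := by
  rw [facet, dodecahedron_eq_hull, hull_inter_plane (range_vertex_subset_halfSpace hn)]

theorem vertex_mem_facet_iff {v : euclVertices} {n : Fin 3 → ℝ} :
    vertex v ∈ facet n ↔ n ⬝ᵥ v.1 = φ ^ 2 := by
  rw [facet, dodecahedron_eq_hull, Set.mem_inter_iff, vertex_mem_plane_iff]
  exact and_iff_right (subset_hull _ ⟨v, rfl⟩)

theorem isOuterNormal_facet {n : Fin 3 → ℝ} (hn : n ∈ euclNormals) :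
    IsOuterNormal dodecahedron (facet n) (normalVec n) :=
  isOuterNormal_inter_plane (Set.mem_image_of_mem _ hn) (form_normalVec_self_pos hn)

theorem exists_eq_facet {F : Set H3} (hF : IsFace 2 dodecahedron F) :
    ∃ n ∈ euclNormals, F = facet n := by
  obtain ⟨_, ⟨n, hn, rfl⟩, h⟩ := hF.exists_eq_inter_plane (finite_euclNormals.image _)
    (Set.forall_mem_image.2 fun _ => form_normalVec_self_pos)
  exact ⟨n, hn, h⟩

theorem form_normalVec_eq_zero_of_facet_inter_nonempty {n m : Fin 3 → ℝ} (hn : n ∈ euclNormals)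
    (hm : m ∈ euclNormals) (hnm : n ≠ m) (h : (facet n ∩ facet m).Nonempty) :
    form (normalVec n) (normalVec m) = 0 := by
  have hsub : Set.range vertex ∩ plane (normalVec n) ⊆ halfSpace (normalVec m) :=
    Set.inter_subset_left.trans (range_vertex_subset_halfSpace hm)
  have hmeet : (facet n ∩ plane (normalVec m)).Nonempty :=
    h.mono (Set.inter_subset_inter_right _ Set.inter_subset_right)
  rw [facet_eq_hull hn, hull_inter_plane hsub] at hmeet
  obtain ⟨_, ⟨⟨v, rfl⟩, hvn⟩, hvm⟩ := nonempty_of_nonempty_hull hmeet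
  rw [form_normalVec_normalVec, sub_eq_zero]
  exact dotProduct_eq_goldenRatio_of_common_vertex hn hm v.2 hnm (vertex_mem_plane_iff.1 hvn)
    (vertex_mem_plane_iff.1 hvm)

theorem hasDihedralAngle_facet {n m : Fin 3 → ℝ} (hn : n ∈ euclNormals) (hm : m ∈ euclNormals)
    (hnm : n ≠ m) (h : (facet n ∩ facet m).Nonempty) :
    HasDihedralAngle dodecahedron (facet n) (facet m) (π / 2) :=
  hasDihedralAngle_pi_div_two (isOuterNormal_facet hn) (isOuterNormal_facet hm)
    (form_normalVec_eq_zero_of_facet_inter_nonempty hn hm hnm h)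

section Pentagon

variable {n : Fin 3 → ℝ} {p m : Fin 5 → Fin 3 → ℝ}

/-- The vertices of a face of the hyperbolic dodecahedron in cyclic order. -/
def IsPentagon.point (h : IsPentagon n p m) (i : Fin 5) : H3 := vertex ⟨p i, h.mem_vertices i⟩

theorem IsPentagon.point_injective (h : IsPentagon n p m) : Function.Injective h.point :=
  fun _ _ hij => h.injective (congrArg Subtype.val (vertex_injective hij))

theorem IsPentagon.point_mem_plane_iff (h : IsPentagon n p m) {i j : Fin 5} :
    h.point j ∈ plane (normalVec (m i)) ↔ j = i ∨ j = i + 1 :=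
  vertex_mem_plane_iff.trans (h.neighbour_iff i j)

theorem IsPentagon.facet_eq_hull (h : IsPentagon n p m) (hn : n ∈ euclNormals) :
    facet n = hull (Set.range h.point) := by
  rw [Hyp.facet_eq_hull hn]
  congr 1
  refine Set.Subset.antisymm ?_ ?_
  · rintro _ ⟨⟨v, rfl⟩, hv⟩
    obtain ⟨i, hi⟩ := h.mem_range v.1 v.2 (vertex_mem_plane_iff.1 hv)
    exact ⟨i, congrArg vertex (Subtype.ext hi)⟩
  · rintro _ ⟨i, rfl⟩
    exact ⟨⟨_, rfl⟩, vertex_mem_plane_iff.2 (h.dotProduct_eq i)⟩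

theorem IsPentagon.facet_inter_plane (h : IsPentagon n p m) (hn : n ∈ euclNormals) (i : Fin 5) :
    facet n ∩ plane (normalVec (m i)) = segment (h.point i) (h.point (i + 1)) := by
  have hsub : Set.range h.point ⊆ halfSpace (normalVec (m i)) := by
    rintro _ ⟨j, rfl⟩
    exact range_vertex_subset_halfSpace (h.mem_normals i) ⟨_, rfl⟩
  rw [h.facet_eq_hull hn, hull_inter_plane hsub, ← hull_pair]
  congr 1
  refine Set.Subset.antisymm ?_ ?_
  · rintro _ ⟨⟨j, rfl⟩, hj⟩
    exact (h.point_mem_plane_iff.1 hj).imp (congrArg h.point) (congrArg h.point)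
  · rintro _ (rfl | rfl)
    exacts [⟨⟨_, rfl⟩, h.point_mem_plane_iff.2 (.inl rfl)⟩,
      ⟨⟨_, rfl⟩, h.point_mem_plane_iff.2 (.inr rfl)⟩]

theorem IsPentagon.finrank_linearSpan_side (h : IsPentagon n p m) (i : Fin 5) :
    Module.finrank ℝ (linearSpan (segment (h.point i) (h.point (i + 1)))) = 2 :=
  finrank_linearSpan_segment (h.point_injective.ne (by decide +revert))

theorem IsPentagon.finrank_linearSpan_facet (h : IsPentagon n p m) (hn : n ∈ euclNormals) :
    Module.finrank ℝ (linearSpan (facet n)) = 3 := by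
  refine le_antisymm ?_ ?_
  · rw [← finrank_ker_formL (form_normalVec_self_pos hn)]
    exact Submodule.finrank_mono (linearSpan_le_ker Set.inter_subset_right)
  · have hside := h.facet_inter_plane hn 0
    have hnot : ¬facet n ⊆ plane (normalVec (m 0)) := fun hsub => by
      have hmem : h.point 2 ∈ facet n := vertex_mem_facet_iff.2 (h.dotProduct_eq 2)
      exact absurd (h.point_mem_plane_iff.1 (hsub hmem)) (by decide)
    have hlt := finrank_linearSpan_lt (hside ▸ Set.inter_subset_left)
      (hside ▸ Set.inter_subset_right) hnot
    rwa [h.finrank_linearSpan_side] at hlt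

theorem IsPentagon.form_point (h : IsPentagon n p m) (i j : Fin 5) :
    form (h.point i).1 (h.point j).1 = φ / 2 * (p i ⬝ᵥ p j - (2 * φ + 1)) := by
  rw [point, point, vertex_val, vertex_val, form_coneMap_coneMap, goldenRatio_pow_three, mul_one,
    mul_one]

theorem IsPentagon.form_point_succ (h : IsPentagon n p m) (i : Fin 5) :
    form (h.point i).1 (h.point (i + 1)).1 = -φ := by
  rw [h.form_point, h.dotProduct_succ]
  ring

theorem IsPentagon.angleAt_point (h : IsPentagon n p m) (i : Fin 5) :
    angleAt (h.point (i - 1)) (h.point i) (h.point (i + 1)) = π / 2 := by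
  have hpred : form (h.point i).1 (h.point (i - 1)).1 = -φ := by
    rw [form_comm, ← h.form_point_succ (i - 1), sub_add_cancel]
  apply angleAt_eq_pi_div_two
  rw [hpred, h.form_point_succ, h.form_point, h.dotProduct_pred_succ]
  ring

theorem IsPentagon.isFace_side (h : IsPentagon n p m) (hn : n ∈ euclNormals) (i : Fin 5) :
    IsFace 1 (facet n) (segment (h.point i) (h.point (i + 1))) :=
  ⟨⟨normalVec (m i), form_normalVec_self_pos (h.mem_normals i),
    Set.inter_subset_left.trans (dodecahedron_subset_halfSpace (h.mem_normals i)),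
    (h.facet_inter_plane hn i).symm⟩, h.finrank_linearSpan_side i⟩

theorem IsPentagon.isRegularPolygon (h : IsPentagon n p m) (hn : n ∈ euclNormals) :
    IsRegularPolygon 5 (π / 2) (facet n) :=
  ⟨by norm_num, h.point, h.point_injective,
    ⟨normalVec n, form_normalVec_self_pos hn, Set.inter_subset_right⟩, h.facet_eq_hull hn,
    h.isFace_side hn, ⟨Real.arcosh φ, fun i => congrArg Real.arcosh
      (neg_eq_iff_eq_neg.2 (h.form_point_succ i))⟩, h.angleAt_point⟩

end Pentagon

theorem isFace_facet {n : Fin 3 → ℝ} (hn : n ∈ euclNormals) : IsFace 2 dodecahedron (facet n) := by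
  obtain ⟨p, m, h⟩ := exists_isPentagon hn
  exact ⟨⟨_, isOuterNormal_facet hn⟩, h.finrank_linearSpan_facet hn⟩

theorem facet_injOn : Set.InjOn facet euclNormals := by
  intro n hn m hm hnm
  by_contra hne
  have hface := isFace_facet hn
  have hker := ker_formL_eq_of_subset_plane (form_normalVec_self_pos hn)
    (form_normalVec_self_pos hm) Set.inter_subset_right
    (hnm.subset.trans Set.inter_subset_right) hface.2
  have horth := form_normalVec_eq_zero_of_facet_inter_nonempty hn hm hne
    (by rw [← hnm, Set.inter_self]; exact hface.nonempty)
  have hmem : normalVec m ∈ LinearMap.ker (formL (normalVec n)) := horth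
  rw [hker] at hmem
  exact (form_normalVec_self_pos hm).ne' hmem

theorem isConvexDodecahedron_dodecahedron : IsConvexDodecahedron dodecahedron := by
  refine ⟨isConvexPolyhedron_dodecahedron,
    Equiv.ofBijective (fun v => ⟨vertex v, isVertex_dodecahedron_iff.2 ⟨v, rfl⟩⟩)
      ⟨fun v w h => vertex_injective (congrArg Subtype.val h), fun x => ?_⟩,
    Equiv.ofBijective (fun n => ⟨facet n.1, isFace_facet n.2⟩)
      ⟨fun n m h => Subtype.ext (facet_injOn n.2 m.2 (congrArg Subtype.val h)), fun F => ?_⟩,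
    fun v n => vertex_mem_facet_iff⟩
  · obtain ⟨v, hv⟩ := isVertex_dodecahedron_iff.1 x.2
    exact ⟨v, Subtype.ext hv⟩
  · obtain ⟨n, hn, hF⟩ := exists_eq_facet F.2
    exact ⟨⟨n, hn⟩, Subtype.ext hF.symm⟩

end Hyp

end

theorem mainTheorem10 :
    ∃ C : Set Hyp.H3, Hyp.IsConvexDodecahedron C ∧
      (∀ F, Hyp.IsFace 2 C F → Hyp.IsRegularPolygon 5 (Real.pi / 2) F) ∧
      (∀ F G, Hyp.IsFace 2 C F → Hyp.IsFace 2 C G → F ≠ G → Hyp.IsFace 1 C (F ∩ G) →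
        Hyp.HasDihedralAngle C F G (Real.pi / 2)) := by
  refine ⟨Hyp.dodecahedron, Hyp.isConvexDodecahedron_dodecahedron, fun F hF => ?_,
    fun F G hF hG hne hFG => ?_⟩
  · obtain ⟨n, hn, rfl⟩ := Hyp.exists_eq_facet hF
    obtain ⟨p, m, h⟩ := Hyp.exists_isPentagon hn
    exact h.isRegularPolygon hn
  · obtain ⟨n, hn, rfl⟩ := Hyp.exists_eq_facet hF
    obtain ⟨m, hm, rfl⟩ := Hyp.exists_eq_facet hG
    exact Hyp.hasDihedralAngle_facet hn hm (fun h => hne (by rw [h])) hFG.nonempty
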